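/- Let $\mathcal L$ be a finite relational language and let $K$ be a Fraïssé class of finite $\mathcal L$-structures, containing a nonempty structure, with the strong amalgamation property (SAP): for all $A,B,C\in K$ and embeddings $e:A\to B$, $f:A\to C$ there are $D\in K$ and embeddings $g:B\to D$, $h:C\to D$ with $ge=hf$ and $\operatorname{im}(g)\cap\operatorname{im}(h)=\operatorname{im}(ge)$. Let $T$ be the complete theory of the Fraïssé limit of $K$. Let $\mathcal L_{pfc}$ be the two-sorted language with sorts $O$ and $P$ which has, for each $n$-ary relation symbol $R$ of $\mathcal L$, a relation symbol $R_x(y_1,\dots,y_n)$ with $x$ of sort $P$ and $y_1,\dots,y_n$ of sort $O$. For an $\mathcal L_{pfc}$-structure $(A,B)$ (with $A$ the sort $O$ and $B$ the sort $P$) and $b\in B$, let $A_b$ be the $\mathcal L$-structure with domain $A$ in which each $R$ is interpreted as $R_b$. Let $K_{pfc}$ be the class of finite $\mathcal L_{pfc}$-structures $(A,B)$ such that for every $b\in B$ the structure $A_b$ is isomorphic to a member of $K$. Let $T_{pfc}$ be the complete theory of the Fraïssé limit of $K_{pfc}$, i.e. of the countable ultrahomogeneous $\mathcal L_{pfc}$-structure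 with age $K_{pfc}$ (which exists and is unique up to isomorphism). A theory is called geometric if it eliminates the quantifier $\exists^\infty$ (for every formula $\varphi(x,\bar y)$ with $x$ a single variable there is a formula $\psi(\bar y)$ such that in every model, $\psi(\bar b)$ holds if and only if $\varphi(x,\bar b)$ has infinitely many solutions) and the model-theoretic algebraic closure $\operatorname{acl}$ satisfies the exchange property in all of its models. If $T$ is geometric and $\operatorname{acl}(A)=A$ for every subset $A$ of every model of $T$, then $T_{pfc}$ is geometric and $\operatorname{acl}(A)=A$ for every subset $A$ of every model of $T_{pfc}$. -/

import Mathlib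

open FirstOrder FirstOrder.Language CategoryTheory

universe u v w w'

/-- The strong amalgamation property (SAP) of a class of structures. -/
def StrongAmalgamation {L : FirstOrder.Language.{u, v}} (K : Set (Bundled.{w} L.Structure)) : Prop :=
  ∀ A B C : Bundled.{w} L.Structure, A ∈ K → B ∈ K → C ∈ K →
    ∀ (e : A ↪[L] B) (f : A ↪[L] C),
      ∃ D : Bundled.{w} L.Structure, D ∈ K ∧ ∃ (g : B ↪[L] D) (h : C ↪[L] D),
        g.comp e = h.comp f ∧
          Set.range g ∩ Set.range h = Set.range (g.comp e)

/-- The model-theoretic algebraic closure of a set `A` in an `L`-structure `M`: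
the union of all finite subsets of `M` that are definable with parameters from `A`. -/
def acl (L : FirstOrder.Language.{u, v}) {M : Type w} [L.Structure M] (A : Set M) : Set M :=
  {a | ∃ s : Set M, A.Definable₁ L s ∧ s.Finite ∧ a ∈ s}

/-- `T` eliminates the quantifier "there exist infinitely many": for every formula `φ(x, y)`,
with `x` a single variable and `y` a tuple, there is a formula `ψ(y)` such that in all models of
`T`, `ψ(b)` holds if and only if `φ(x, b)` has infinitely many solutions. -/
def EliminatesExistsInfinity {L : FirstOrder.Language.{u, v}} (T : L.Theory) : Prop :=
  ∀ (n : ℕ) (φ : L.Formula (Fin (n + 1))), ∃ ψ : L.Formula (Fin n),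
    ∀ (M : Theory.ModelType.{u, v, w} T) (b : Fin n → M),
      ψ.Realize b ↔ {a : M | φ.Realize (Fin.cons a b : Fin (n + 1) → M)}.Infinite

/-- Algebraic closure satisfies the exchange property in all models of `T`. -/
def AclExchange {L : FirstOrder.Language.{u, v}} (T : L.Theory) : Prop :=
  ∀ (M : Theory.ModelType.{u, v, w} T) (A : Set M) (a b : M),
    a ∈ acl L (A ∪ {b}) → a ∉ acl L A → b ∈ acl L (A ∪ {a})

/-- Geometric theories. The models range over the universe `w`. -/
structure IsGeometric {L : FirstOrder.Language.{u, v}} (T : L.Theory) : Prop where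
  eliminatesExistsInfinity : EliminatesExistsInfinity.{u, v, w} T
  aclExchange : AclExchange.{u, v, w} T

/-- The condition `acl(A) = A` for every subset `A` of every model of `T`. -/
def HasTrivialAcl {L : FirstOrder.Language.{u, v}} (T : L.Theory) : Prop :=
  ∀ (M : Theory.ModelType.{u, v, w} T) (A : Set M), acl L A = A

/-- The relation symbols of the language `L_pfc`. The two sorts `O` and `P` are given by unary
predicates; every `n`-ary relation symbol `R` of `L` yields an `(n + 1)`-ary symbol `R_x(y)`,
whose first argument `x` is of sort `P` and whose other arguments `y` are of sort `O`. -/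
inductive PfcRelations (L : FirstOrder.Language.{u, v}) : ℕ → Type v
  | sortO : PfcRelations L 1
  | sortP : PfcRelations L 1
  | rel {n : ℕ} (R : L.Relations n) : PfcRelations L (n + 1)

/-- The two-sorted language `L_pfc`. -/
def pfcLanguage (L : FirstOrder.Language.{u, v}) : FirstOrder.Language.{0, v} :=
  ⟨fun _ => Empty, PfcRelations L⟩

instance pfcLanguage.instIsRelational (L : FirstOrder.Language.{u, v}) : (pfcLanguage L).IsRelational :=
  fun _ => inferInstanceAs (IsEmpty Empty)

/-- A two-sorted `L_pfc`-structure `(A, B)`, with `A` the sort `O` and `B` the sort `P`, is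
the same thing as a family `S` of `L`-structures on `A` indexed by `B`, where `S b` is the
`L`-structure `A_b` associated to `b`. Its universe is the disjoint union of the two sorts. -/
@[reducible] def pfcStructure {L : FirstOrder.Language.{u, v}} {A B : Type w} (S : B → L.Structure A) :
    (pfcLanguage L).Structure (A ⊕ B) where
  funMap := fun f _ => f.elim
  RelMap := fun {n} (r : PfcRelations L n) =>
    match n, r with
    | _, .sortO => fun x => ∃ a : A, x 0 = Sum.inl a
    | _, .sortP => fun x => ∃ b : B, x 0 = Sum.inr b
    | _, .rel (n := k) R => fun x => ∃ (b : B) (a : Fin k → A),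
        x = Fin.cons (Sum.inr b) (fun i => Sum.inl (a i)) ∧ (S b).RelMap R a

/-- The class `K_pfc` of (structures isomorphic to) finite two-sorted `L_pfc`-structures
`(A, B)` such that for every `b` in `B`, `A_b` is isomorphic to some member of `K`. -/
def pfcClass {L : FirstOrder.Language.{u, v}} (K : Set (Bundled.{w} L.Structure)) :
    Set (Bundled.{w} (pfcLanguage L).Structure) :=
  {M | ∃ (A B : Type w) (S : B → L.Structure A), Finite A ∧ Finite B ∧
    (∀ b : B, ∃ D ∈ K, Nonempty (@FirstOrder.Language.Equiv L A D (S b) D.str)) ∧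
    Nonempty (@FirstOrder.Language.Equiv (pfcLanguage L) M (A ⊕ B) M.str (pfcStructure S))}

/-!
If algebraic closure is trivial, then exchange is immediate, and `φ(b, x)` has infinitely many
solutions as soon as it has one outside `b`, which is expressible by a formula. In an
ultrahomogeneous structure `M` whose age has strong amalgamation, any two finite sets containing `A`
can be moved to intersect only in `A` by an automorphism of `M` fixing `A`, so that in a relational
language every subset of `M` is algebraically closed. Triviality passes from `M` to the models of
its theory, because it is expressed by the sentences saying that a formula `φ(b, x)` with a solution
outside `b` has a solution outside any given finite set.

Hence it suffices that `K_pfc` is a Fraïssé class with strong amalgamation. To amalgamate `(A₂, B₂)`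
and `(A₃, B₃)` over `(A₁, B₁)`, let `A` and `B` be the pushouts of the sorts and amalgamate in `K`
separately at every `b ∈ B`. Over a point `b` of `B₂` outside `B₁`, the set `A₃` carries no
structure yet; one is chosen on it by embedding `A₁` into the infinite Fraïssé limit of `K` and
extending the embedding to an injection of `A₃`. The Fraïssé limit of `K_pfc` itself is the union of
a generic ideal of finite structures on subsets of `ℕ`.
-/

section TrivialAcl

variable {L : FirstOrder.Language.{u, v}} {M : Type*} [L.Structure M] {β κ : Type*}

/-- The set of solutions of `φ(b, x)` in `x`; the index type `Fin 1` of the variable `x` is the one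
that `Set.Definable₁` uses. -/
def solutionSet (φ : L.Formula (β ⊕ Fin 1)) (b : β → M) : Set M :=
  {x | φ.Realize (Sum.elim b fun _ => x)}

theorem definable₁_solutionSet (φ : L.Formula (β ⊕ Fin 1)) (b : β → M) :
    (Set.range b).Definable₁ L (solutionSet φ b) := by
  refine Set.definable_iff_exists_formula_sum.2
    ⟨φ.relabel (Sum.map (Set.rangeFactorization b) id), Set.ext fun x => ?_⟩
  have hx : x = fun _ => x 0 := funext fun i => congrArg x (Subsingleton.elim i 0)
  change φ.Realize _ ↔ Formula.Realize _ _
  rw [Formula.realize_relabel, Sum.elim_comp_map, Function.comp_id, ← hx]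
  rfl

theorem exists_solutionSet_eq {A s : Set M} (hs : A.Definable₁ L s) :
    ∃ (F : Finset M) (φ : L.Formula (F ⊕ Fin 1)), ↑F ⊆ A ∧ solutionSet φ (↑) = s := by
  obtain ⟨F, hF, hdef⟩ := Set.definable_iff_finitely_definable.1 hs
  obtain ⟨φ, hφ⟩ := Set.definable_iff_exists_formula_sum.1 hdef
  exact ⟨F, φ, hF, Set.ext fun x => (Set.ext_iff.1 hφ fun _ => x).symm⟩

theorem apply_mem_solutionSet (φ : L.Formula (β ⊕ Fin 1)) {b : β → M} (σ : M ≃[L] M)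
    (hσ : ∀ i, σ (b i) = b i) {a : M} (ha : a ∈ solutionSet φ b) : σ a ∈ solutionSet φ b := by
  have hφ := (StrongHomClass.realize_formula σ φ).2 ha
  rwa [Sum.comp_elim, show σ ∘ b = b from funext hσ] at hφ

theorem subset_acl (A : Set M) : A ⊆ acl L A :=
  fun a ha => ⟨{a}, Set.Definable.singleton_of_mem L ha, Set.finite_singleton a, rfl⟩

theorem infinite_solutionSet_of_acl_range {φ : L.Formula (β ⊕ Fin 1)} {b : β → M}
    (hb : acl L (Set.range b) = Set.range b) {a : M} (ha : a ∈ solutionSet φ b)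
    (hab : a ∉ Set.range b) : (solutionSet φ b).Infinite :=
  fun hfin => hab (hb ▸ ⟨_, definable₁_solutionSet φ b, hfin, ha⟩)

/-- The formula expressing that `φ(y, x)` has a solution `x` outside the tuple `(y (f j))ⱼ`. -/
noncomputable def existsNotMem [Finite κ] (f : κ → β) (φ : L.Formula (β ⊕ Fin 1)) : L.Formula β :=
  Formula.iExs (Fin 1) (φ ⊓ Formula.iInf fun j : κ =>
    (Term.equal (Term.var (Sum.inr 0)) (Term.var (Sum.inl (f j)))).not)

theorem realize_existsNotMem [Finite κ] (f : κ → β) (φ : L.Formula (β ⊕ Fin 1)) (b : β → M) :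
    (existsNotMem f φ).Realize b ↔ ∃ a ∈ solutionSet φ b, a ∉ Set.range (b ∘ f) := by
  simp only [existsNotMem, Formula.realize_iExs, Formula.realize_inf, Formula.realize_iInf,
    Formula.realize_not, Formula.realize_equal, Term.realize_var, Sum.elim_inl, Sum.elim_inr,
    solutionSet, Set.mem_ofPred_eq, Set.mem_range, Function.comp_apply, not_exists]
  constructor
  · rintro ⟨x, hx, hne⟩
    have hx' : x = fun _ => x 0 := funext fun i => congrArg x (Subsingleton.elim i 0)
    exact ⟨x 0, hx' ▸ hx, fun j h => hne j h.symm⟩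
  · rintro ⟨a, ha, hne⟩
    exact ⟨fun _ => a, ha, fun j h => hne j h.symm⟩

theorem HasTrivialAcl.isGeometric {T : L.Theory} (hT : HasTrivialAcl.{u, v, w} T) :
    IsGeometric.{u, v, w} T where
  eliminatesExistsInfinity n φ := by
    let φ' : L.Formula (Fin n ⊕ Fin 1) :=
      φ.relabel (Fin.cons (Sum.inr 0) Sum.inl : Fin (n + 1) → Fin n ⊕ Fin 1)
    refine ⟨existsNotMem id φ', fun N b => ?_⟩
    have hφ' : solutionSet φ' b = {a : N | φ.Realize (Fin.cons a b : Fin (n + 1) → N)} := by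
      ext a
      rw [solutionSet, Set.mem_ofPred_eq, Set.mem_ofPred_eq, Formula.realize_relabel]
      apply iff_of_eq
      congr 1
      funext i
      cases i using Fin.cases <;> rfl
    rw [realize_existsNotMem, ← hφ']
    constructor
    · rintro ⟨a, ha, hab⟩
      exact infinite_solutionSet_of_acl_range (hT N _) ha hab
    · exact fun hinf => hinf.exists_notMem_finite (Set.finite_range b)
  aclExchange N A a b ha hna := by
    rw [hT N] at ha hna ⊢
    exact Or.inr (ha.resolve_left hna).symm

/-- The sentence expressing, over all tuples `y` and `z`, that if `φ(y, x)` has a solution outside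
`y`, then it has a solution outside `z`. -/
noncomputable def avoidanceSentence [Finite β] (κ : Type*) [Finite κ]
    (φ : L.Formula (β ⊕ Fin 1)) : L.Sentence :=
  Formula.iAlls (β ⊕ κ) (((existsNotMem id φ).relabel Sum.inl |>.imp
    (existsNotMem Sum.inr (φ.relabel (Sum.map Sum.inl id)))).relabel (Sum.inr (α := Empty)))

theorem realize_avoidanceSentence [Finite β] [Finite κ] (φ : L.Formula (β ⊕ Fin 1)) :
    M ⊨ avoidanceSentence κ φ ↔ ∀ (b : β → M) (c : κ → M),
      (∃ a ∈ solutionSet φ b, a ∉ Set.range b) → ∃ a ∈ solutionSet φ b, a ∉ Set.range c := by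
  have hφ (b : β ⊕ κ → M) : solutionSet (φ.relabel (Sum.map Sum.inl id)) b =
      solutionSet φ (b ∘ Sum.inl) := by
    ext a
    rw [solutionSet, solutionSet, Set.mem_ofPred_eq, Formula.realize_relabel, Sum.elim_comp_map]
    rfl
  simp only [Sentence.Realize, avoidanceSentence, Formula.realize_iAlls, Formula.realize_relabel,
    Formula.realize_imp, realize_existsNotMem, hφ, Function.comp_id]
  exact ⟨fun h b c => h (Sum.elim b c), fun h x => h (x ∘ Sum.inl) (x ∘ Sum.inr)⟩

theorem hasTrivialAcl_completeTheory (hM : ∀ A : Set M, acl L A = A) :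
    HasTrivialAcl.{u, v, w} (L.completeTheory M) := by
  refine fun N A => Set.Subset.antisymm ?_ (subset_acl A)
  rintro a ⟨s, hs, hfin, has⟩
  obtain ⟨F, φ, hFA, rfl⟩ := exists_solutionSet_eq hs
  by_contra haA
  have : Finite (solutionSet φ ((↑) : F → N)) := hfin
  have hMφ : M ⊨ avoidanceSentence (solutionSet φ ((↑) : F → N)) φ :=
    (realize_avoidanceSentence φ).2 fun b c ⟨x, hx, hxb⟩ =>
      (infinite_solutionSet_of_acl_range (hM _) hx hxb).exists_notMem_finite (Set.finite_range c)
  have hNφ := (L.completeTheory M).realize_sentence_of_mem (M := N) hMφ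
  obtain ⟨x, hx, hxs⟩ := (realize_avoidanceSentence φ).1 hNφ (↑) (↑)
    ⟨a, has, fun ⟨y, hy⟩ => haA (hy ▸ hFA y.2)⟩
  exact hxs ⟨⟨x, hx⟩, rfl⟩

end TrivialAcl

section UltrahomogeneousStructure

variable {L : FirstOrder.Language.{u, v}} {M : Type w} [L.Structure M]

/-- Amalgamate `T` and `U` strongly over `S`, embed the amalgam into `M` over `T`, and extend the
resulting copy of `U` in `M` to an automorphism. -/
theorem StrongAmalgamation.exists_automorphism (hSAP : StrongAmalgamation (L.age M))
    (hM : L.IsUltrahomogeneous M) {S T U : L.Substructure M} (hS : S.FG) (hT : T.FG) (hU : U.FG)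
    (hST : S ≤ T) (hSU : S ≤ U) :
    ∃ σ : M ≃[L] M, (∀ x ∈ S, σ x = x) ∧ ∀ x ∈ U, σ x ∈ T → x ∈ S := by
  obtain ⟨D, ⟨-, ⟨d⟩⟩, g, h, hgh, hrange⟩ := hSAP _ _ _ (age.fg_substructure hS)
    (age.fg_substructure hT) (age.fg_substructure hU)
    (Substructure.inclusion hST) (Substructure.inclusion hSU)
  have : Nonempty (D ↪[L] M) := ⟨d⟩
  obtain ⟨j, hj⟩ := hM.extend_embedding ((Substructure.fg_iff_structure_fg _).1 hT) T.subtype g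
  obtain ⟨σ, hσ⟩ := hM U hU (j.comp h)
  replace hj (x : T) : j (g x) = x := (DFunLike.congr_fun hj x).symm
  replace hσ (x : U) : σ x = j (h x) := (DFunLike.congr_fun hσ x).symm
  replace hgh (x : S) : g (Substructure.inclusion hST x) = h (Substructure.inclusion hSU x) :=
    DFunLike.congr_fun hgh x
  refine ⟨σ, fun x hx => ?_, fun x hxU hxT => ?_⟩
  · exact (hσ ⟨x, hSU hx⟩).trans ((congrArg j (hgh ⟨x, hx⟩).symm).trans (hj ⟨x, hST hx⟩))
  · have hx : g ⟨σ x, hxT⟩ = h ⟨x, hxU⟩ := j.injective ((hj _).trans (hσ ⟨x, hxU⟩))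
    obtain ⟨y, hy⟩ : h ⟨x, hxU⟩ ∈ Set.range (g.comp (Substructure.inclusion hST)) :=
      hrange ▸ ⟨⟨_, hx⟩, ⟨_, rfl⟩⟩
    obtain rfl : (y : M) = x := congrArg Subtype.val (h.injective ((hgh y).symm.trans hy))
    exact y.2

theorem StrongAmalgamation.acl_subset_closure (hSAP : StrongAmalgamation (L.age M))
    (hM : L.IsUltrahomogeneous M) (A : Set M) : acl L A ⊆ Substructure.closure L A := by
  rintro a ⟨s, hs, hfin, has⟩
  obtain ⟨F, φ, hFA, rfl⟩ := exists_solutionSet_eq hs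
  have hF : (F : Set M).Finite := F.finite_toSet
  obtain ⟨σ, hσ, hσa⟩ := hSAP.exists_automorphism hM (Substructure.fg_closure hF)
    (Substructure.fg_closure (hF.union hfin)) (Substructure.fg_closure (hF.insert a))
    (Substructure.closure_mono Set.subset_union_left)
    (Substructure.closure_mono (Set.subset_insert a F))
  have hσs : σ a ∈ solutionSet φ (↑) :=
    apply_mem_solutionSet φ σ (fun x => hσ x (Substructure.subset_closure x.2)) has
  exact Substructure.closure_mono hFA (hσa a (Substructure.subset_closure (Set.mem_insert a F))
    (Substructure.subset_closure (Or.inr hσs)))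

theorem StrongAmalgamation.infinite [L.IsRelational] [Nonempty M]
    (hSAP : StrongAmalgamation (L.age M)) (hM : L.IsUltrahomogeneous M) : Infinite M := by
  obtain ⟨a⟩ := ‹Nonempty M›
  by_contra hfin
  rw [not_infinite_iff_finite] at hfin
  have htop : (⊤ : L.Substructure M).FG := Substructure.FG.of_finite
  obtain ⟨σ, -, hσ⟩ := hSAP.exists_automorphism hM Substructure.fg_bot htop htop bot_le bot_le
  have ha : a ∈ (⊥ : L.Substructure M) := hσ a trivial trivial
  rw [← Substructure.closure_empty, Substructure.mem_closure_iff_of_isRelational] at ha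
  exact ha

theorem StrongAmalgamation.hasTrivialAcl [L.IsRelational] (hSAP : StrongAmalgamation (L.age M))
    (hM : L.IsUltrahomogeneous M) : HasTrivialAcl.{u, v, w'} (L.completeTheory M) :=
  hasTrivialAcl_completeTheory fun A => Set.Subset.antisymm
    ((hSAP.acl_subset_closure hM A).trans (Substructure.closure_eq_of_isRelational L A).subset)
    (subset_acl A)

end UltrahomogeneousStructure

section FraisseLimit

variable {L : FirstOrder.Language.{u, v}} {K : Set (Bundled.{w} L.Structure)}

theorem exists_embedding_lift {A P N : Type*} [L.Structure A] [L.Structure P] [L.Structure N]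
    (f : A ↪[L] N) (i : P ↪[L] N) (h : Set.range f ⊆ Set.range i) :
    ∃ e : A ↪[L] P, ∀ a, i (e a) = f a := by
  refine ⟨i.equivRange.symm.toEmbedding.comp
    (f.codRestrict i.toHom.range fun a => h (Set.mem_range_self a)), fun a => ?_⟩
  exact congrArg Subtype.val (i.equivRange.apply_symm_apply _)

theorem nonempty_embedding_of_finite_of_infinite (A Ω : Type*) [Finite A] [Infinite Ω] :
    Nonempty (A ↪ Ω) :=
  ⟨(Finite.equivFin A).toEmbedding.trans (Fin.valEmbedding.trans (Infinite.natEmbedding Ω))⟩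

theorem exists_injective_extension {A B Ω : Type*} [Finite B] [Infinite Ω] {g : A → B}
    (hg : Function.Injective g) {f : A → Ω} (hf : Function.Injective f) :
    ∃ k : B → Ω, Function.Injective k ∧ ∀ a, k (g a) = f a := by
  classical
  have : Finite A := Finite.of_injective g hg
  have : Infinite ↥(Set.range f)ᶜ := (Set.finite_range f).infinite_compl.to_subtype
  obtain ⟨i⟩ := nonempty_embedding_of_finite_of_infinite ↥(Set.range g)ᶜ ↥(Set.range f)ᶜ
  let k : Set.range g ⊕ ↥(Set.range g)ᶜ → Ω :=
    Sum.elim (f ∘ (Equiv.ofInjective g hg).symm) (Subtype.val ∘ i)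
  have hk : Function.Injective k :=
    (hf.comp (Equiv.injective _)).sumElim (Subtype.val_injective.comp i.injective)
      fun a b h => (i b).2 ⟨_, h⟩
  refine ⟨k ∘ (Equiv.Set.sumCompl (Set.range g)).symm, hk.comp (Equiv.injective _), fun a => ?_⟩
  simp [k, Equiv.Set.sumCompl_symm_apply_of_mem (Set.mem_range_self a)]

theorem isUltrahomogeneous_of_exists_extension {N : Type*} [L.Structure N] [Countable N]
    (hN : ∀ (S T : L.Substructure N), S.FG → T.FG → ∀ (hST : S ≤ T) (f : S ↪[L] N),
      ∃ g : T ↪[L] N, g.comp (Substructure.inclusion hST) = f) : L.IsUltrahomogeneous N := by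
  rw [isUltrahomogeneous_iff_IsExtensionPair Structure.cg_of_countable]
  rintro ⟨f, hf⟩ m
  have hT : (f.dom ⊔ Substructure.closure L {m}).FG := hf.sup (Substructure.fg_closure_singleton m)
  obtain ⟨g, hg⟩ := hN _ _ hf hT le_sup_left (f.cod.subtype.comp f.toEquiv.toEmbedding)
  exact ⟨⟨⟨_, g.toHom.range, g.equivRange⟩, hT⟩,
    Substructure.subset_closure.trans (le_sup_right : _ ≤ f.dom ⊔ _) (Set.mem_singleton m),
    le_sup_left, hg⟩

theorem inducedStructure_toEquiv {A B : Type*} [L.Structure A] [S : L.Structure B]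
    (e : A ≃[L] B) : e.toEquiv.inducedStructure (L := L) = S := by
  have h {n : ℕ} (x : Fin n → B) : e ∘ e.toEquiv.symm ∘ x = x :=
    funext fun i => e.apply_symm_apply (x i)
  ext n s x
  · exact (e.map_fun s _).trans (congrArg (S.funMap s) (h x))
  · exact (e.map_rel s _).symm.trans (by rw [h x])

/-- A member of the class `K` whose universe is a finite subset of `Ω`. Ordered by extension, these
are the conditions of the forcing construction of a Fraïssé limit with universe inside `Ω`. -/
structure FinsetStructure (K : Set (Bundled.{w} L.Structure)) (Ω : Type w) where
  carrier : Finset Ω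
  str : L.Structure carrier
  mem : ⟨carrier, str⟩ ∈ K

namespace FinsetStructure

variable {Ω : Type w}

instance (p : FinsetStructure K Ω) : L.Structure p.carrier := p.str

instance : Preorder (FinsetStructure K Ω) where
  le p q := ∃ e : p.carrier ↪[L] q.carrier, ∀ x, (e x : Ω) = x
  le_refl p := ⟨Embedding.refl L _, fun _ => rfl⟩
  le_trans _ _ _ := fun ⟨e, he⟩ ⟨f, hf⟩ => ⟨f.comp e, fun x => (hf _).trans (he x)⟩

theorem mem_of_le {p q : FinsetStructure K Ω} (h : p ≤ q) {x : Ω} (hx : x ∈ p.carrier) :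
    x ∈ q.carrier := by
  obtain ⟨e, he⟩ := h
  simpa only [he] using (e ⟨x, hx⟩).2

theorem exists_equiv (hK : IsFraisse K) {B : Type w} [L.Structure B] [Finite B]
    (hB : ⟨B, inferInstance⟩ ∈ K) {k : B → Ω} (hk : Function.Injective k) :
    ∃ (q : FinsetStructure K Ω) (e : B ≃[L] q.carrier), ∀ b, (e b : Ω) = k b := by
  let F : Finset Ω := (Set.finite_range k).toFinset
  let e : B ≃ F := (Equiv.ofInjective k hk).trans
    (Equiv.subtypeEquivRight fun x => by simp [F])
  let str : L.Structure F := e.inducedStructure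
  let e' : B ≃[L] F := e.inducedStructureEquiv
  exact ⟨⟨F, str, (hK.is_equiv_invariant ⟨e'⟩).1 hB⟩, e', fun _ => rfl⟩

/-- A structure on a finite set `F` is induced by a bijection from `F` to a representative of its
isomorphism class, and there are only countably many such bijections. -/
theorem countable [Countable Ω] (hK : IsFraisse K) (hfin : ∀ A ∈ K, Finite A) :
    Countable (FinsetStructure K Ω) := by
  have := hK.is_essentially_countable.to_subtype
  have hout (c : ↥(Quotient.mk' '' K)) : c.1.out ∈ K := by
    obtain ⟨_, A, hA, rfl⟩ := c
    exact (hK.is_equiv_invariant (Quotient.mk_out A)).2 hA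
  have (F : Finset Ω) (c : ↥(Quotient.mk' '' K)) : Finite (F ≃ c.1.out) :=
    have := hfin _ (hout c)
    inferInstance
  let ofEquiv : (Σ (F : Finset Ω) (c : ↥(Quotient.mk' '' K)), F ≃ c.1.out) →
      FinsetStructure K Ω := fun ⟨F, c, e⟩ =>
    ⟨F, e.symm.inducedStructure, (hK.is_equiv_invariant ⟨e.symm.inducedStructureEquiv⟩).1 (hout c)⟩
  refine Function.Surjective.countable (f := ofEquiv) fun ⟨F, S, hF⟩ => ?_
  let c : ↥(Quotient.mk' '' K) := ⟨Quotient.mk' ⟨F, S⟩, ⟨F, S⟩, hF, rfl⟩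
  obtain ⟨e⟩ : Nonempty (c.1.out ≃[L] F) := Quotient.mk_out (⟨F, S⟩ : Bundled.{w} L.Structure)
  refine ⟨⟨F, c, e.toEquiv.symm⟩, ?_⟩
  simp only [ofEquiv, Equiv.symm_symm, inducedStructure_toEquiv]

/-- The structures that realize the extension `p ≤ q`, or are incompatible with `p`. -/
def realizing (p q : FinsetStructure K Ω) : Set (FinsetStructure K Ω) :=
  {r | (∃ k : q.carrier ↪[L] r.carrier, ∀ x : q.carrier, (x : Ω) ∈ p.carrier → (k x : Ω) = x) ∨
    ¬ ∃ s, r ≤ s ∧ p ≤ s}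

/-- The universe of the union of an ideal of structures. -/
abbrev IdealUnion (I : Order.Ideal (FinsetStructure K Ω)) : Type w :=
  {x : Ω // ∃ r ∈ I, x ∈ r.carrier}

variable {I : Order.Ideal (FinsetStructure K Ω)}

theorem exists_mem_of_finite {F : Set (IdealUnion I)} (hF : F.Finite) :
    ∃ r ∈ I, ∀ x ∈ F, (x : Ω) ∈ r.carrier := by
  induction F, hF using Set.Finite.induction_on with
  | empty => exact I.nonempty.imp fun r hr => ⟨hr, fun x hx => absurd hx (Set.notMem_empty x)⟩
  | @insert a F _ _ ih =>
    obtain ⟨r, hr, hrF⟩ := ih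
    obtain ⟨s, hs, has⟩ := a.2
    obtain ⟨t, ht, hrt, hst⟩ := I.directed r hr s hs
    exact ⟨t, ht, Set.forall_mem_insert.2 ⟨mem_of_le hst has, fun x hx => mem_of_le hrt (hrF x hx)⟩⟩

variable [L.IsRelational]

instance : L.Structure (IdealUnion I) where
  funMap F _ := isEmptyElim F
  RelMap R x := ∃ r ∈ I, ∃ y : _ → r.carrier, (∀ i, (y i : Ω) = x i) ∧ Structure.RelMap R y

/-- The inclusion of a member of an ideal into the union. -/
def toUnion {r : FinsetStructure K Ω} (hr : r ∈ I) : r.carrier ↪[L] IdealUnion I where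
  toFun x := ⟨x, r, hr, x.2⟩
  inj' _ _ h := Subtype.ext (congrArg (fun x : IdealUnion I => (x : Ω)) h)
  map_fun' F _ := isEmptyElim F
  map_rel' R x := by
    refine ⟨fun ⟨s, hs, y, hy, hR⟩ => ?_, fun h => ⟨r, hr, x, fun _ => rfl, h⟩⟩
    obtain ⟨t, -, ⟨e, he⟩, ⟨f, hf⟩⟩ := I.directed r hr s hs
    have hxy : e ∘ x = f ∘ y :=
      funext fun i => Subtype.ext ((he _).trans ((hf _).trans (hy i)).symm)
    rwa [← e.map_rel, hxy, f.map_rel]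

theorem exists_equiv_of_embedding (hK : IsFraisse K) {A : Type w} [L.Structure A] [Finite A]
    (f : A ↪[L] IdealUnion I) : ∃ p ∈ I, ∃ e : A ≃[L] p.carrier, ∀ a, (e a : Ω) = f a := by
  obtain ⟨r, hr, hrf⟩ := exists_mem_of_finite (Set.finite_range f)
  obtain ⟨f', hf'⟩ := exists_embedding_lift f (toUnion hr) <| by
    rintro _ ⟨a, rfl⟩
    exact ⟨⟨f a, hrf _ ⟨a, rfl⟩⟩, rfl⟩
  have hA : ⟨A, inferInstance⟩ ∈ K :=
    hK.hereditary _ r.mem ⟨Structure.fg_iff_finite.2 ‹_›, ⟨f'⟩⟩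
  obtain ⟨p, e, he⟩ := exists_equiv hK hA (Subtype.val_injective.comp f.injective)
  refine ⟨p, I.lower ⟨f'.comp e.symm.toEmbedding, fun x => ?_⟩ hr, e, he⟩
  have hx : (f (e.symm x) : Ω) = x := by rw [← Function.comp_apply (f := Subtype.val), ← he]; simp
  rw [← hx, ← hf']
  rfl

theorem isCofinal_realizing [Infinite Ω] (hK : IsFraisse K) {p q : FinsetStructure K Ω}
    (hpq : p ≤ q) : IsCofinal (realizing p q) := by
  intro r
  by_cases hr : ∃ s, r ≤ s ∧ p ≤ s
  · obtain ⟨s, hrs, i, hi⟩ := hr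
    obtain ⟨j, hj⟩ := hpq
    obtain ⟨D, g, h, hD, hgh⟩ := hK.amalgamation _ _ _ i j p.mem s.mem q.mem
    have : Finite D := (hK.FG D hD).finite
    obtain ⟨k, hk, hkg⟩ := exists_injective_extension g.injective
      (Subtype.val_injective : Function.Injective ((↑) : s.carrier → Ω))
    obtain ⟨t, e, he⟩ := exists_equiv hK hD hk
    refine ⟨t, Or.inl ⟨e.toEmbedding.comp h, fun x hx => ?_⟩,
      hrs.trans ⟨e.toEmbedding.comp g, fun x => (he _).trans (hkg x)⟩⟩
    have hjx : j ⟨x, hx⟩ = x := Subtype.ext (hj _)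
    have hx' : h x = g (i ⟨x, hx⟩) :=
      (congrArg h hjx).symm.trans (DFunLike.congr_fun hgh _).symm
    calc (e (h x) : Ω) = k (g (i ⟨x, hx⟩)) := by rw [he, hx']
      _ = x := (hkg _).trans (hi _)
  · exact ⟨r, Or.inr hr, le_rfl⟩

/-- An ideal is generic if it realizes all extensions compatible with it. -/
def IsGeneric (I : Order.Ideal (FinsetStructure K Ω)) : Prop :=
  ∀ p q : FinsetStructure K Ω, p ≤ q → ∃ r ∈ I, r ∈ realizing p q

theorem IsGeneric.exists_extension [Infinite Ω] (hI : IsGeneric I) (hK : IsFraisse K)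
    {A B : Type w} [L.Structure A] [L.Structure B] (hB : ⟨B, inferInstance⟩ ∈ K)
    (f : A ↪[L] IdealUnion I) (g : A ↪[L] B) :
    ∃ h : B ↪[L] IdealUnion I, h.comp g = f := by
  have : Finite B := (hK.FG _ hB).finite
  have : Finite A := Finite.of_injective g g.injective
  obtain ⟨p, hp, e, he⟩ := exists_equiv_of_embedding hK f
  obtain ⟨k, hk, hkg⟩ :=
    exists_injective_extension g.injective (Subtype.val_injective.comp f.injective)
  obtain ⟨q, e', he'⟩ := exists_equiv hK hB hk
  have hfg (a : A) : (e' (g a) : Ω) = e a := ((he' _).trans (hkg a)).trans (he a).symm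
  have hpq : p ≤ q := ⟨(e'.toEmbedding.comp g).comp e.symm.toEmbedding, fun x =>
    (hfg _).trans (congrArg Subtype.val (e.apply_symm_apply x))⟩
  obtain ⟨s, hs, hs'⟩ := hI p q hpq
  obtain ⟨t, -, hst, hpt⟩ := I.directed s hs p hp
  obtain ⟨j, hj⟩ := hs'.resolve_right fun h => h ⟨t, hst, hpt⟩
  refine ⟨(toUnion hs).comp (j.comp e'.toEmbedding), Embedding.ext fun a => Subtype.ext ?_⟩
  calc (j (e' (g a)) : Ω) = e' (g a) := hj _ (hfg a ▸ (e a).2)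
    _ = f a := (hfg a).trans (he a)

theorem IsGeneric.isFraisseLimit [Infinite Ω] [Countable Ω] (hI : IsGeneric I)
    (hK : IsFraisse K) : IsFraisseLimit K (IdealUnion I) where
  ultrahomogeneous := isUltrahomogeneous_of_exists_extension fun S T _ hT hST f => by
    have := hT.finite
    obtain ⟨p, -, e, -⟩ := exists_equiv_of_embedding hK T.subtype
    exact hI.exists_extension hK ((hK.is_equiv_invariant ⟨e⟩).2 p.mem) f _
  age := by
    refine Set.Subset.antisymm (fun A ⟨hA, ⟨f⟩⟩ => ?_) fun A hA => ⟨hK.FG A hA, ?_⟩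
    · have := hA.finite
      obtain ⟨p, -, e, -⟩ := exists_equiv_of_embedding hK f
      exact (hK.is_equiv_invariant ⟨e⟩).2 p.mem
    · obtain ⟨p, hp⟩ := I.nonempty
      obtain ⟨D, hD, ⟨g⟩, ⟨h⟩⟩ := hK.jointEmbedding _ p.mem A hA
      obtain ⟨i, -⟩ := hI.exists_extension hK hD (toUnion hp) g
      exact ⟨i.comp h⟩

theorem exists_isGeneric [Infinite Ω] [Countable Ω] (hK : IsFraisse K) :
    ∃ I : Order.Ideal (FinsetStructure K Ω), IsGeneric I := by
  have := countable (Ω := Ω) hK fun A hA => (hK.FG A hA).finite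
  let _ : Encodable {pq : FinsetStructure K Ω × FinsetStructure K Ω // pq.1 ≤ pq.2} :=
    Encodable.ofCountable _
  obtain ⟨A, hA⟩ := hK.is_nonempty
  have : Finite A := (hK.FG A hA).finite
  obtain ⟨k⟩ := nonempty_embedding_of_finite_of_infinite A Ω
  obtain ⟨p₀, -⟩ := exists_equiv hK hA k.injective
  let 𝒟 (pq : {pq : FinsetStructure K Ω × FinsetStructure K Ω // pq.1 ≤ pq.2}) :
      Order.Cofinal (FinsetStructure K Ω) := ⟨_, isCofinal_realizing hK pq.2⟩
  refine ⟨Order.idealOfCofinals p₀ 𝒟, fun p q hpq => ?_⟩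
  obtain ⟨r, hr, hrI⟩ := Order.cofinal_meets_idealOfCofinals p₀ 𝒟 ⟨(p, q), hpq⟩
  exact ⟨r, hrI, hr⟩

end FinsetStructure

theorem exists_isFraisseLimit [L.IsRelational] (hK : IsFraisse K) :
    ∃ (N : Type w) (_ : L.Structure N) (_ : Countable N), IsFraisseLimit K N := by
  obtain ⟨I, hI⟩ := FinsetStructure.exists_isGeneric (Ω := ULift.{w} ℕ) hK
  exact ⟨FinsetStructure.IdealUnion I, inferInstance, inferInstance, hI.isFraisseLimit hK⟩

end FraisseLimit

section Comap

variable {L : FirstOrder.Language.{u, v}} [L.IsRelational] {K : Set (Bundled.{w} L.Structure)}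

/-- The relational structure on `A` pulled back from `S` along `f : A → B`; for injective `f` this
is the unique structure on `A` making `f` an embedding. -/
@[reducible] def comapStructure {A B : Type*} (f : A → B) (S : L.Structure B) : L.Structure A where
  funMap F _ := isEmptyElim F
  RelMap R x := S.RelMap R (f ∘ x)

theorem comapStructure_eq_iff {A B : Type*} {f : A → B} {S : L.Structure B} {T : L.Structure A} :
    comapStructure f S = T ↔
      ∀ (n : ℕ) (R : L.Relations n) (x : Fin n → A), S.RelMap R (f ∘ x) ↔ T.RelMap R x := by
  refine ⟨fun h n R x => h ▸ Iff.rfl, fun h => ?_⟩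
  ext n R x
  · exact isEmptyElim R
  · exact h n R x

theorem comapStructure_embedding {A B : Type*} [S : L.Structure A] [T : L.Structure B]
    (e : A ↪[L] B) : comapStructure e T = S :=
  comapStructure_eq_iff.2 fun _ => e.map_rel

/-- An injection is an embedding of the structure pulled back along it. -/
def embeddingOfComap {A B : Type*} [S : L.Structure A] [T : L.Structure B] (f : A → B)
    (hf : Function.Injective f) (h : comapStructure f T = S) : A ↪[L] B where
  toFun := f
  inj' := hf
  map_fun' F _ := isEmptyElim F
  map_rel' := comapStructure_eq_iff.1 h _

theorem comapStructure_mem (hK : Hereditary K) {A B : Type w} [Finite A] {f : A → B}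
    (hf : Function.Injective f) {S : L.Structure B} (hS : ⟨B, S⟩ ∈ K) :
    ⟨A, comapStructure f S⟩ ∈ K :=
  hK _ hS ⟨(@Structure.fg_iff_finite L A (comapStructure f S) _).2 ‹_›,
    ⟨@embeddingOfComap L _ A B (comapStructure f S) S f hf rfl⟩⟩

theorem exists_extension_to_finite {M : Type w} [L.Structure M] [Infinite M] {A C : Type w}
    [Finite C] {f : A → C} (hf : Function.Injective f) {S : L.Structure A}
    (hS : ⟨A, S⟩ ∈ L.age M) :
    ∃ T : L.Structure C, ⟨C, T⟩ ∈ L.age M ∧ comapStructure f T = S := by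
  obtain ⟨-, ⟨e⟩⟩ := hS
  obtain ⟨k, hk, hkf⟩ := exists_injective_extension hf e.injective
  replace hkf : k ∘ f = e := funext hkf
  refine ⟨comapStructure k inferInstance, ⟨?_, ⟨?_⟩⟩, ?_⟩
  · exact (@Structure.fg_iff_finite L C (comapStructure k _) _).2 ‹_›
  · exact @embeddingOfComap L _ C M (comapStructure k _) _ k hk rfl
  · change comapStructure (k ∘ f) _ = S
    exact hkf ▸ comapStructure_embedding e

theorem finite_structure [Finite (Σ n, L.Relations n)] (A : Type*) [Finite A] :
    Finite (L.Structure A) := by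
  refine Finite.of_injective
    (fun (S : L.Structure A) (R : Σ n, L.Relations n) => {x : Fin R.1 → A | S.RelMap R.2 x})
    fun S T h => ?_
  ext n R x
  · exact isEmptyElim R
  · exact Set.ext_iff.1 (congrFun h ⟨n, R⟩) x

theorem countable_quotient_of_finite [Finite (Σ n, L.Relations n)] (hK : ∀ A ∈ K, Finite A) :
    (Quotient.mk' '' K).Countable := by
  have (n : ℕ) : Finite (L.Structure (ULift.{w} (Fin n))) := finite_structure _
  refine (Set.countable_range fun S : Σ n : ℕ, L.Structure (ULift.{w} (Fin n)) =>
    (Quotient.mk' ⟨_, S.2⟩ : Quotient (equivSetoid.{u, v, w} (L := L)))).mono ?_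
  rintro _ ⟨A, hA, rfl⟩
  have := hK A hA
  let e : A ≃ ULift.{w} (Fin (Nat.card A)) := (Finite.equivFin A).trans Equiv.ulift.symm
  exact ⟨⟨_, e.inducedStructure⟩, Quotient.sound (Setoid.symm ⟨e.inducedStructureEquiv⟩)⟩

end Comap

section Pushout

variable {X Y Z P : Type w} {f : X → Y} {g : X → Z} {i : Y → P} {j : Z → P}

/-- The square `i ∘ f = j ∘ g` of injections presents `P` as the union of `Y` and `Z` with
intersection `X`. -/
structure IsInjectivePushout (f : X → Y) (g : X → Z) (i : Y → P) (j : Z → P) : Prop where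
  fst_injective : Function.Injective f
  snd_injective : Function.Injective g
  inl_injective : Function.Injective i
  inr_injective : Function.Injective j
  condition : ∀ x, i (f x) = j (g x)
  exists_of_eq : ∀ {y z}, i y = j z → ∃ x, f x = y ∧ g x = z
  mem_range_or : ∀ p, p ∈ Set.range i ∨ p ∈ Set.range j

namespace IsInjectivePushout

theorem exists_of_injective (hf : Function.Injective f) (hg : Function.Injective g) :
    ∃ (P : Type w) (i : Y → P) (j : Z → P), IsInjectivePushout f g i j := by
  classical
  let e : Set.range g ⊕ ↥(Set.range g)ᶜ ≃ Z := Equiv.Set.sumCompl (Set.range g)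
  let k : Set.range g ⊕ ↥(Set.range g)ᶜ → Y ⊕ ↥(Set.range g)ᶜ :=
    Sum.map (f ∘ (Equiv.ofInjective g hg).symm) id
  have hk : Function.Injective k :=
    (hf.comp (Equiv.injective _)).sumMap Function.injective_id
  have hkg (x : X) : k (e.symm (g x)) = Sum.inl (f x) := by
    simp [k, e, Equiv.Set.sumCompl_symm_apply_of_mem (Set.mem_range_self x)]
  refine ⟨Y ⊕ ↥(Set.range g)ᶜ, Sum.inl, k ∘ e.symm, hf, hg, Sum.inl_injective,
    hk.comp e.symm.injective, fun x => (hkg x).symm, fun {y z} h => ?_, ?_⟩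
  · by_cases hz : z ∈ Set.range g
    · obtain ⟨x, rfl⟩ := hz
      exact ⟨x, Sum.inl_injective ((hkg x).symm.trans h.symm), rfl⟩
    · simp [k, e, Equiv.Set.sumCompl_symm_apply_of_notMem hz] at h
  · rintro (y | z)
    · exact Or.inl ⟨y, rfl⟩
    · exact Or.inr ⟨z, by simp [k, e, Equiv.Set.sumCompl_symm_apply_of_notMem z.2]⟩

theorem symm (h : IsInjectivePushout f g i j) : IsInjectivePushout g f j i where
  fst_injective := h.snd_injective
  snd_injective := h.fst_injective
  inl_injective := h.inr_injective
  inr_injective := h.inl_injective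
  condition x := (h.condition x).symm
  exists_of_eq hzy := (h.exists_of_eq hzy.symm).imp fun _ => And.symm
  mem_range_or p := (h.mem_range_or p).symm

theorem sumMap (h : IsInjectivePushout f g i j) {X' Y' Z' P' : Type w} {f' : X' → Y'}
    {g' : X' → Z'} {i' : Y' → P'} {j' : Z' → P'} (h' : IsInjectivePushout f' g' i' j') :
    IsInjectivePushout (Sum.map f f') (Sum.map g g') (Sum.map i i') (Sum.map j j') where
  fst_injective := h.fst_injective.sumMap h'.fst_injective
  snd_injective := h.snd_injective.sumMap h'.snd_injective
  inl_injective := h.inl_injective.sumMap h'.inl_injective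
  inr_injective := h.inr_injective.sumMap h'.inr_injective
  condition
    | Sum.inl x => congrArg Sum.inl (h.condition x)
    | Sum.inr x => congrArg Sum.inr (h'.condition x)
  exists_of_eq := by
    rintro (y | y) (z | z) hyz
    · obtain ⟨x, rfl, rfl⟩ := h.exists_of_eq (Sum.inl_injective hyz)
      exact ⟨Sum.inl x, rfl, rfl⟩
    · cases hyz
    · cases hyz
    · obtain ⟨x, rfl, rfl⟩ := h'.exists_of_eq (Sum.inr_injective hyz)
      exact ⟨Sum.inr x, rfl, rfl⟩
  mem_range_or
    | Sum.inl p => (h.mem_range_or p).imp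
        (fun ⟨y, hy⟩ => ⟨Sum.inl y, congrArg Sum.inl hy⟩)
        (fun ⟨z, hz⟩ => ⟨Sum.inl z, congrArg Sum.inl hz⟩)
    | Sum.inr p => (h'.mem_range_or p).imp
        (fun ⟨y, hy⟩ => ⟨Sum.inr y, congrArg Sum.inr hy⟩)
        (fun ⟨z, hz⟩ => ⟨Sum.inr z, congrArg Sum.inr hz⟩)

theorem finite [Finite Y] [Finite Z] (h : IsInjectivePushout f g i j) : Finite P :=
  Set.finite_univ_iff.1 <| ((Set.finite_range i).union (Set.finite_range j)).subset
    fun p _ => h.mem_range_or p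

theorem range_inter_range (h : IsInjectivePushout f g i j) :
    Set.range i ∩ Set.range j = Set.range (i ∘ f) := by
  refine Set.Subset.antisymm ?_ ?_
  · rintro _ ⟨⟨y, rfl⟩, ⟨z, hz⟩⟩
    obtain ⟨x, rfl, -⟩ := h.exists_of_eq hz.symm
    exact ⟨x, rfl⟩
  · rintro _ ⟨x, rfl⟩
    exact ⟨⟨f x, rfl⟩, ⟨g x, (h.condition x).symm⟩⟩

theorem exists_injective_desc (h : IsInjectivePushout f g i j) {D : Type*} {d : Y → D} {e : Z → D}
    (hd : Function.Injective d) (he : Function.Injective e) (hde : ∀ x, d (f x) = e (g x))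
    (hinter : ∀ {y z}, d y = e z → ∃ x, f x = y ∧ g x = z) :
    ∃ ψ : P → D, Function.Injective ψ ∧ ψ ∘ i = d ∧ ψ ∘ j = e := by
  have hψ (p : P) : ∃ c, (∀ y, i y = p → d y = c) ∧ ∀ z, j z = p → e z = c := by
    rcases h.mem_range_or p with ⟨y, rfl⟩ | ⟨z, rfl⟩
    · refine ⟨d y, fun y' hy => by rw [h.inl_injective hy], fun z hz => ?_⟩
      obtain ⟨x, rfl, rfl⟩ := h.exists_of_eq hz.symm
      exact (hde x).symm
    · refine ⟨e z, fun y hy => ?_, fun z' hz => by rw [h.inr_injective hz]⟩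
      obtain ⟨x, rfl, rfl⟩ := h.exists_of_eq hy
      exact hde x
  choose ψ hψi hψj using hψ
  replace hψi (y : Y) : ψ (i y) = d y := (hψi _ y rfl).symm
  replace hψj (z : Z) : ψ (j z) = e z := (hψj _ z rfl).symm
  have heq {y : Y} {z : Z} (hyz : d y = e z) : i y = j z := by
    obtain ⟨x, rfl, rfl⟩ := hinter hyz
    exact h.condition x
  refine ⟨ψ, fun p q hpq => ?_, funext hψi, funext hψj⟩
  rcases h.mem_range_or p with ⟨y, rfl⟩ | ⟨z, rfl⟩ <;>
    rcases h.mem_range_or q with ⟨y', rfl⟩ | ⟨z', rfl⟩ <;> simp only [hψi, hψj] at hpq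
  · rw [hd hpq]
  · exact heq hpq
  · exact (heq hpq.symm).symm
  · rw [he hpq]

end IsInjectivePushout

variable {L : FirstOrder.Language.{u, v}} [L.IsRelational] {K : Set (Bundled.{w} L.Structure)}

theorem StrongAmalgamation.exists_structure_pushout [Finite X] [Finite P]
    (hSAP : StrongAmalgamation K) (hK : Hereditary K) (h : IsInjectivePushout f g i j)
    {S : L.Structure Y} (hS : ⟨Y, S⟩ ∈ K) {T : L.Structure Z} (hT : ⟨Z, T⟩ ∈ K)
    (hST : comapStructure f S = comapStructure g T) :
    ∃ U : L.Structure P, ⟨P, U⟩ ∈ K ∧ comapStructure i U = S ∧ comapStructure j U = T := by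
  let R : L.Structure X := comapStructure f S
  obtain ⟨⟨D, V⟩, hD, d, e, hde, hrange⟩ := hSAP ⟨X, R⟩ ⟨Y, S⟩ ⟨Z, T⟩
    (comapStructure_mem hK h.fst_injective hS) hS hT
    (embeddingOfComap f h.fst_injective rfl) (embeddingOfComap g h.snd_injective hST.symm)
  replace hde (x : X) : d (f x) = e (g x) := DFunLike.congr_fun hde x
  have hinter {y : Y} {z : Z} (hyz : d y = e z) : ∃ x, f x = y ∧ g x = z := by
    obtain ⟨x, hx⟩ := hrange.subset ⟨⟨y, rfl⟩, ⟨z, hyz.symm⟩⟩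
    have hfx : f x = y := d.injective hx
    exact ⟨x, hfx, e.injective (by rw [← hde, hfx, hyz])⟩
  obtain ⟨ψ, hψ, hψi, hψj⟩ := h.exists_injective_desc d.injective e.injective hde hinter
  refine ⟨comapStructure ψ V, comapStructure_mem hK hψ hD, ?_, ?_⟩
  · change comapStructure (ψ ∘ i) V = S
    exact hψi ▸ comapStructure_embedding d
  · change comapStructure (ψ ∘ j) V = T
    exact hψj ▸ comapStructure_embedding e

section Family

variable {M : Type w} [L.Structure M] [Infinite M] [Finite Y] [Finite Z]
  {X' Y' Z' P' : Type w} {f' : X' → Y'} {g' : X' → Z'} {i' : Y' → P'} {j' : Z' → P'}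
  {S : Y' → L.Structure Y} {T : Z' → L.Structure Z}

theorem StrongAmalgamation.exists_structure_pushout_inl (hSAP : StrongAmalgamation (L.age M))
    (h : IsInjectivePushout f g i j) (h' : IsInjectivePushout f' g' i' j')
    (hS : ∀ y, ⟨Y, S y⟩ ∈ L.age M) (hT : ∀ z, ⟨Z, T z⟩ ∈ L.age M)
    (hST : ∀ x, comapStructure f (S (f' x)) = comapStructure g (T (g' x))) (y : Y') :
    ∃ U : L.Structure P, ⟨P, U⟩ ∈ L.age M ∧ comapStructure i U = S y ∧
      ∀ z, i' y = j' z → comapStructure j U = T z := by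
  have : Finite X := Finite.of_injective f h.fst_injective
  have : Finite P := h.finite
  have hage : Hereditary (L.age M) := age.hereditary M
  -- If no structure on `Z` is prescribed at `y`, extend the one on `X` arbitrarily.
  by_cases hy : ∃ x, f' x = y
  · obtain ⟨x, rfl⟩ := hy
    obtain ⟨U, hU, hi, hj⟩ :=
      hSAP.exists_structure_pushout hage h (hS (f' x)) (hT (g' x)) (hST x)
    refine ⟨U, hU, hi, fun z hz => ?_⟩
    obtain ⟨x', hx', rfl⟩ := h'.exists_of_eq hz
    rwa [h'.fst_injective hx']
  · obtain ⟨T₀, hT₀, hg⟩ :=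
      exists_extension_to_finite h.snd_injective (comapStructure_mem hage h.fst_injective (hS y))
    obtain ⟨U, hU, hi, -⟩ := hSAP.exists_structure_pushout hage h (hS y) hT₀ hg.symm
    refine ⟨U, hU, hi, fun z hz => ?_⟩
    obtain ⟨x, hx, -⟩ := h'.exists_of_eq hz
    exact absurd ⟨x, hx⟩ hy

theorem StrongAmalgamation.exists_family_pushout (hSAP : StrongAmalgamation (L.age M))
    (h : IsInjectivePushout f g i j) (h' : IsInjectivePushout f' g' i' j')
    (hS : ∀ y, ⟨Y, S y⟩ ∈ L.age M) (hT : ∀ z, ⟨Z, T z⟩ ∈ L.age M)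
    (hST : ∀ x, comapStructure f (S (f' x)) = comapStructure g (T (g' x))) :
    ∃ U : P' → L.Structure P, (∀ p, ⟨P, U p⟩ ∈ L.age M) ∧
      (∀ y, comapStructure i (U (i' y)) = S y) ∧ ∀ z, comapStructure j (U (j' z)) = T z := by
  have hU (p : P') : ∃ U : L.Structure P, ⟨P, U⟩ ∈ L.age M ∧
      (∀ y, i' y = p → comapStructure i U = S y) ∧
      ∀ z, j' z = p → comapStructure j U = T z := by
    rcases h'.mem_range_or p with ⟨y, rfl⟩ | ⟨z, rfl⟩
    · obtain ⟨U, hU, hi, hj⟩ := hSAP.exists_structure_pushout_inl h h' hS hT hST y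
      exact ⟨U, hU, fun y' hy => h'.inl_injective hy ▸ hi, fun z hz => hj z hz.symm⟩
    · obtain ⟨U, hU, hj, hi⟩ :=
        hSAP.exists_structure_pushout_inl h.symm h'.symm hT hS (fun x => (hST x).symm) z
      exact ⟨U, hU, fun y hy => hi y hy.symm, fun z' hz => h'.inr_injective hz ▸ hj⟩
  choose U hU hi hj using hU
  exact ⟨U, hU, fun y => hi _ y rfl, fun z => hj _ z rfl⟩

end Family

end Pushout

section Classes

variable {L : FirstOrder.Language.{u, v}} {K : Set (Bundled.{w} L.Structure)}

theorem StrongAmalgamation.of_equiv {K' : Set (Bundled.{w} L.Structure)}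
    (hSAP : StrongAmalgamation K') (hsub : K' ⊆ K)
    (hiso : ∀ X ∈ K, ∃ Y ∈ K', Nonempty (X ≃[L] Y)) : StrongAmalgamation K := by
  intro A B C hA hB hC e f
  obtain ⟨A', hA', ⟨a⟩⟩ := hiso A hA
  obtain ⟨B', hB', ⟨b⟩⟩ := hiso B hB
  obtain ⟨C', hC', ⟨c⟩⟩ := hiso C hC
  obtain ⟨D, hD, g, h, hgh, hrange⟩ := hSAP A' B' C' hA' hB' hC'
    ((b.toEmbedding.comp e).comp a.symm.toEmbedding)
    ((c.toEmbedding.comp f).comp a.symm.toEmbedding)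
  refine ⟨D, hsub hD, g.comp b.toEmbedding, h.comp c.toEmbedding, Embedding.ext fun x => ?_, ?_⟩
  · simpa using DFunLike.congr_fun hgh (a x)
  · have hg : Set.range (g.comp b.toEmbedding) = Set.range g := b.surjective.range_comp g
    have hh : Set.range (h.comp c.toEmbedding) = Set.range h := c.surjective.range_comp h
    rw [hg, hh, hrange]
    exact a.symm.surjective.range_comp (g.comp (b.toEmbedding.comp e))

theorem StrongAmalgamation.amalgamation (hSAP : StrongAmalgamation K) : Amalgamation K :=
  fun A B C e f hA hB hC =>
    let ⟨D, hD, g, h, hgh, _⟩ := hSAP A B C hA hB hC e f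
    ⟨D, g, h, hD, hgh⟩

/-- The embedding of an empty structure, which exists because there are no nullary symbols. -/
def embeddingOfIsEmpty [L.IsRelational] [IsEmpty (L.Relations 0)] {A B : Type*} [L.Structure A]
    [L.Structure B] [IsEmpty A] : A ↪[L] B where
  toFun := isEmptyElim
  inj' x := isEmptyElim x
  map_fun' F _ := isEmptyElim F
  map_rel' {n} R x := by
    cases n with
    | zero => exact isEmptyElim R
    | succ n => exact isEmptyElim (x 0)

theorem jointEmbedding_of_amalgamation [L.IsRelational] [IsEmpty (L.Relations 0)]
    (hK : Hereditary K) (hamalg : Amalgamation K) : JointEmbedding K := by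
  intro A hA B hB
  obtain ⟨D, g, h, hD, -⟩ := hamalg ⟨(⊥ : L.Substructure A), inferInstance⟩ A B
    embeddingOfIsEmpty embeddingOfIsEmpty (hK A hA (age.fg_substructure Substructure.fg_bot)) hA hB
  exact ⟨D, hD, ⟨g⟩, ⟨h⟩⟩

theorem isFraisse_of_strongAmalgamation [L.IsRelational] [IsEmpty (L.Relations 0)]
    [Finite (Σ n, L.Relations n)] (hne : K.Nonempty) (hfin : ∀ A ∈ K, Finite A)
    (hK : Hereditary K) (hSAP : StrongAmalgamation K) : IsFraisse K where
  is_nonempty := hne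
  FG A hA := Structure.fg_iff_finite.2 (hfin A hA)
  is_essentially_countable := countable_quotient_of_finite hfin
  hereditary := hK
  jointEmbedding := jointEmbedding_of_amalgamation hK hSAP.amalgamation
  amalgamation := hSAP.amalgamation

end Classes

section Pfc

variable {L : FirstOrder.Language.{u, v}} {K : Set (Bundled.{w} L.Structure)}
  {A B A' B' : Type w} {S : B → L.Structure A} {S' : B' → L.Structure A'}

instance : IsEmpty ((pfcLanguage L).Relations 0) :=
  ⟨fun R : PfcRelations L 0 => nomatch R⟩

instance [Finite (Σ n, L.Relations n)] : Finite (Σ n, (pfcLanguage L).Relations n) := by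
  let relation : Option (Option (Σ n, L.Relations n)) → Σ n, PfcRelations L n
    | none => ⟨1, PfcRelations.sortO⟩
    | some none => ⟨1, PfcRelations.sortP⟩
    | some (some R) => ⟨R.1 + 1, PfcRelations.rel R.2⟩
  refine Finite.of_surjective relation ?_
  rintro ⟨_, _ | _ | R⟩
  · exact ⟨none, rfl⟩
  · exact ⟨some none, rfl⟩
  · exact ⟨some (some ⟨_, R⟩), rfl⟩

theorem pfcStructure_relMap_rel {n : ℕ} (R : L.Relations n) (b : B) (a : Fin n → A) :
    (pfcStructure S).RelMap (PfcRelations.rel R : (pfcLanguage L).Relations (n + 1))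
      (Fin.cons (Sum.inr b) (Sum.inl ∘ a)) ↔ (S b).RelMap R a := by
  refine ⟨fun ⟨b', a', h, hR⟩ => ?_, fun h => ⟨b, a, rfl, h⟩⟩
  obtain ⟨hb, ha⟩ := Fin.cons_injective2 h
  obtain rfl := Sum.inr_injective hb
  obtain rfl : a = a' := funext fun i => Sum.inl_injective (congrFun ha i)
  exact hR

theorem exists_eq_cons_of_sumMap_comp_eq {α : A → A'} {β : B → B'} {n : ℕ}
    {x : Fin (n + 1) → A ⊕ B} {b' : B'} {a' : Fin n → A'}
    (h : Sum.map α β ∘ x = Fin.cons (Sum.inr b') (Sum.inl ∘ a')) :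
    ∃ b a, x = Fin.cons (Sum.inr b) (Sum.inl ∘ a) ∧ β b = b' ∧ α ∘ a = a' := by
  have hzero : ∃ b, x 0 = Sum.inr b ∧ β b = b' := by
    have h0 : Sum.map α β (x 0) = Sum.inr b' := congrFun h 0
    cases hx : x 0 <;> simp_all
  have hsucc (i : Fin n) : ∃ a, x i.succ = Sum.inl a ∧ α a = a' i := by
    have hi : Sum.map α β (x i.succ) = Sum.inl (a' i) := congrFun h i.succ
    cases hx : x i.succ <;> simp_all
  obtain ⟨b, hb, hb'⟩ := hzero
  choose a ha ha' using hsucc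
  exact ⟨b, a, funext (Fin.cases hb ha), hb', funext ha'⟩

theorem sumMap_comp_cons {α : A → A'} {β : B → B'} {n : ℕ} (b : B) (a : Fin n → A) :
    Sum.map α β ∘ (Fin.cons (Sum.inr b) (Sum.inl ∘ a) : Fin (n + 1) → A ⊕ B) =
      Fin.cons (Sum.inr (β b)) (Sum.inl ∘ α ∘ a) :=
  funext (Fin.cases rfl fun _ => rfl)

/-- The `L_pfc`-structure `(A, B)` given by a family of structures. -/
def pfcBundled (S : B → L.Structure A) : Bundled.{w} (pfcLanguage L).Structure :=
  ⟨A ⊕ B, pfcStructure S⟩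

theorem finite_of_mem_pfcClass {X : Bundled.{w} (pfcLanguage L).Structure} (hX : X ∈ pfcClass K) :
    Finite X := by
  obtain ⟨A, B, S, hA, hB, -, ⟨i⟩⟩ := hX
  exact Finite.of_equiv (A ⊕ B) (Language.Equiv.toEquiv (N := pfcBundled S) i).symm

/-- The members `(A, B)` of `K_pfc` given literally by a family of members of `K`; these represent
all isomorphism types of `pfcClass K`. -/
def pfcFamilies (K : Set (Bundled.{w} L.Structure)) : Set (Bundled.{w} (pfcLanguage L).Structure) :=
  {X | ∃ (A B : Type w) (S : B → L.Structure A), Finite A ∧ Finite B ∧ (∀ b, ⟨A, S b⟩ ∈ K) ∧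
    X = pfcBundled S}

theorem pfcFamilies_subset_pfcClass : pfcFamilies K ⊆ pfcClass K := by
  rintro _ ⟨A, B, S, hA, hB, hS, rfl⟩
  exact ⟨A, B, S, hA, hB, fun b => ⟨_, hS b, ⟨@Language.Equiv.refl L A (S b)⟩⟩,
    ⟨Language.Equiv.refl _ (pfcBundled S)⟩⟩

theorem pfcClass_nonempty : (pfcClass K).Nonempty :=
  ⟨pfcBundled (A := PEmpty) (B := PEmpty) fun b => b.elim,
    pfcFamilies_subset_pfcClass ⟨_, _, _, inferInstance, inferInstance, fun b => b.elim, rfl⟩⟩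

theorem exists_equiv_sum_comp_eq_sumMap {Y : Type w} (f : Y → A ⊕ B) :
    ∃ (A₀ B₀ : Type w) (i : Y ≃ A₀ ⊕ B₀) (α : A₀ → A) (β : B₀ → B), Sum.map α β ∘ i = f := by
  classical
  let A₀ : Type w := {y : Y // ∃ a, f y = Sum.inl a}
  let B₀ : Type w := {y : Y // ¬ ∃ a, f y = Sum.inl a}
  have hα (y : A₀) : ∃ a, f y = Sum.inl a := y.2
  have hβ (y : B₀) : ∃ b, f y = Sum.inr b := by
    rcases hy : f y with a | b
    · exact absurd ⟨a, hy⟩ y.2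
    · exact ⟨b, rfl⟩
  choose α hα using hα
  choose β hβ using hβ
  let i : A₀ ⊕ B₀ ≃ Y := Equiv.sumCompl _
  have hi : Sum.map α β = f ∘ i := funext (Sum.rec (fun y => (hα y).symm) fun y => (hβ y).symm)
  exact ⟨A₀, B₀, i.symm, α, β, by rw [hi, Function.comp_assoc, i.self_comp_symm, Function.comp_id]⟩

variable [L.IsRelational]

theorem comapStructure_sumMap {α : A → A'} {β : B → B'}
    (h : ∀ b, comapStructure α (S' (β b)) = S b) :
    comapStructure (Sum.map α β) (pfcStructure S') = pfcStructure S := by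
  refine comapStructure_eq_iff.2 fun n R x => ?_
  cases R with
  | sortO =>
    change (∃ a', Sum.map α β (x 0) = Sum.inl a') ↔ ∃ a, x 0 = Sum.inl a
    rcases x 0 with a | b <;> simp
  | sortP =>
    change (∃ b', Sum.map α β (x 0) = Sum.inr b') ↔ ∃ b, x 0 = Sum.inr b
    rcases x 0 with a | b <;> simp
  | rel R =>
    constructor
    · rintro ⟨_, _, hx, hR⟩
      obtain ⟨b, a, rfl, rfl, rfl⟩ := exists_eq_cons_of_sumMap_comp_eq hx
      exact ⟨b, a, rfl, (comapStructure_eq_iff.1 (h b) _ R a).1 hR⟩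
    · rintro ⟨b, a, rfl, hR⟩
      exact ⟨β b, α ∘ a, sumMap_comp_cons b a, (comapStructure_eq_iff.1 (h b) _ R a).2 hR⟩

theorem exists_eq_sumMap (e : pfcBundled S ↪[pfcLanguage L] pfcBundled S') :
    ∃ (α : A → A') (β : B → B'), ⇑e = Sum.map α β ∧ ∀ b, comapStructure α (S' (β b)) = S b := by
  have hO (a : A) : ∃ a', e (Sum.inl a) = Sum.inl a' :=
    (e.map_rel PfcRelations.sortO fun _ => Sum.inl a).2 ⟨a, rfl⟩
  have hP (b : B) : ∃ b', e (Sum.inr b) = Sum.inr b' :=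
    (e.map_rel PfcRelations.sortP fun _ => Sum.inr b).2 ⟨b, rfl⟩
  choose α hα using hO
  choose β hβ using hP
  have he : ⇑e = Sum.map α β := funext (Sum.rec hα hβ)
  refine ⟨α, β, he, fun b => comapStructure_eq_iff.2 fun n R x => ?_⟩
  rw [← pfcStructure_relMap_rel R (β b), ← sumMap_comp_cons, ← he, ← pfcStructure_relMap_rel R b]
  exact e.map_rel (PfcRelations.rel R) _

theorem exists_equiv_mem_pfcFamilies (hK : Hereditary K) {X : Bundled.{w} (pfcLanguage L).Structure}
    (hX : X ∈ pfcClass K) : ∃ Y ∈ pfcFamilies K, Nonempty (X ≃[pfcLanguage L] Y) := by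
  obtain ⟨A, B, S, hA, hB, hS, hXS⟩ := hX
  refine ⟨pfcBundled S, ⟨A, B, S, hA, hB, fun b => ?_, rfl⟩, hXS⟩
  obtain ⟨D, hD, ⟨e⟩⟩ := hS b
  exact hK D hD ⟨(@Structure.fg_iff_finite L A (S b) _).2 hA,
    ⟨@Language.Equiv.toEmbedding L A D (S b) _ e⟩⟩

theorem hereditary_pfcClass (hK : Hereditary K) : Hereditary (pfcClass K) := by
  rintro X hX Y ⟨hY, ⟨e⟩⟩
  have : Finite Y := hY.finite
  obtain ⟨_, ⟨A, B, S, -, -, hS, rfl⟩, ⟨i⟩⟩ := exists_equiv_mem_pfcFamilies hK hX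
  obtain ⟨A₀, B₀, j, α, β, hj⟩ := exists_equiv_sum_comp_eq_sumMap (i.toEmbedding.comp e)
  have : Finite (A₀ ⊕ B₀) := Finite.of_equiv Y j
  have : Finite A₀ := Finite.of_injective (Sum.inl : A₀ → A₀ ⊕ B₀) Sum.inl_injective
  have : Finite B₀ := Finite.of_injective (Sum.inr : B₀ → A₀ ⊕ B₀) Sum.inr_injective
  have hαβ : Function.Injective (Sum.map α β) :=
    (j.injective_comp _).1 (hj ▸ (i.toEmbedding.comp e).injective)
  have hY : comapStructure j (pfcStructure fun b => comapStructure α (S (β b))) = Y.str := by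
    rw [← comapStructure_sumMap fun _ => rfl]
    change comapStructure (Sum.map α β ∘ j) (pfcStructure S) = Y.str
    exact hj ▸ comapStructure_embedding (i.toEmbedding.comp e)
  have hmem (b : B₀) : ⟨A₀, comapStructure α (S (β b))⟩ ∈ K :=
    comapStructure_mem hK (Sum.map_injective.1 hαβ).1 (hS (β b))
  let j' : Y ≃[pfcLanguage L] pfcBundled fun b => comapStructure α (S (β b)) :=
    ⟨j, fun F => isEmptyElim F, comapStructure_eq_iff.1 hY _⟩
  exact ⟨A₀, B₀, _, ‹_›, ‹_›, fun b => ⟨_, hmem b, ⟨@Language.Equiv.refl L A₀ (_)⟩⟩, ⟨j'⟩⟩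

theorem strongAmalgamation_pfcFamilies {M : Type w} [L.Structure M] [Infinite M]
    (hSAP : StrongAmalgamation (L.age M)) : StrongAmalgamation (pfcFamilies (L.age M)) := by
  rintro _ _ _ ⟨A₁, B₁, S₁, -, -, -, rfl⟩ ⟨A₂, B₂, S₂, hA₂, hB₂, hS₂, rfl⟩
    ⟨A₃, B₃, S₃, hA₃, hB₃, hS₃, rfl⟩ e f
  obtain ⟨α₂, β₂, he, h₂⟩ := exists_eq_sumMap e
  obtain ⟨α₃, β₃, hf, h₃⟩ := exists_eq_sumMap f
  obtain ⟨hα₂, hβ₂⟩ := Sum.map_injective.1 (he ▸ e.injective)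
  obtain ⟨hα₃, hβ₃⟩ := Sum.map_injective.1 (hf ▸ f.injective)
  obtain ⟨A, iA, jA, hA⟩ := IsInjectivePushout.exists_of_injective hα₂ hα₃
  obtain ⟨B, iB, jB, hB⟩ := IsInjectivePushout.exists_of_injective hβ₂ hβ₃
  obtain ⟨S, hS, hi, hj⟩ := hSAP.exists_family_pushout hA hB hS₂ hS₃
    fun b => (h₂ b).trans (h₃ b).symm
  have hAB := hA.sumMap hB
  let g : pfcBundled S₂ ↪[pfcLanguage L] pfcBundled S :=
    embeddingOfComap (Sum.map iA iB) hAB.inl_injective (comapStructure_sumMap hi)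
  let h : pfcBundled S₃ ↪[pfcLanguage L] pfcBundled S :=
    embeddingOfComap (Sum.map jA jB) hAB.inr_injective (comapStructure_sumMap hj)
  have hcomp (x : A₁ ⊕ B₁) : g (e x) = h (f x) := by
    rw [he, hf]
    exact hAB.condition x
  refine ⟨pfcBundled S, ⟨A, B, S, hA.finite, hB.finite, hS, rfl⟩, g, h, Embedding.ext hcomp, ?_⟩
  have hge : ⇑(g.comp e) = Sum.map iA iB ∘ Sum.map α₂ β₂ := congrArg (g ∘ ·) he
  exact hge ▸ hAB.range_inter_range

theorem strongAmalgamation_pfcClass {M : Type w} [L.Structure M] [Infinite M]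
    (hSAP : StrongAmalgamation (L.age M)) : StrongAmalgamation (pfcClass (L.age M)) :=
  (strongAmalgamation_pfcFamilies hSAP).of_equiv pfcFamilies_subset_pfcClass
    fun _ => exists_equiv_mem_pfcFamilies (age.hereditary M)

end Pfc

theorem corollary4p7 {L : FirstOrder.Language.{u, v}} [L.IsRelational] [Finite (Σ n, L.Relations n)]
    (K : Set (Bundled.{w} L.Structure)) (hK : IsFraisse K) (hSAP : StrongAmalgamation K)
    (M : Type w) [L.Structure M] [Countable M] [Nonempty M] (hM : IsFraisseLimit K M)
    (hgeom : IsGeometric.{u, v, w'} (L.completeTheory M))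
    (hacl : HasTrivialAcl.{u, v, w'} (L.completeTheory M)) :
    (∃ (N : Type w) (_ : (pfcLanguage L).Structure N) (_ : Countable N),
      IsFraisseLimit (pfcClass K) N) ∧
    ∀ (N : Type w) [(pfcLanguage L).Structure N] [Countable N],
      IsFraisseLimit (pfcClass K) N →
        IsGeometric.{0, v, w'} ((pfcLanguage L).completeTheory N) ∧
          HasTrivialAcl.{0, v, w'} ((pfcLanguage L).completeTheory N) := by
  obtain rfl : L.age M = K := hM.age
  have : Infinite M := hSAP.infinite hM.ultrahomogeneous
  have hSAP' : StrongAmalgamation (pfcClass (L.age M)) := strongAmalgamation_pfcClass hSAP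
  have hFraisse : IsFraisse (pfcClass (L.age M)) :=
    isFraisse_of_strongAmalgamation pfcClass_nonempty (fun _ => finite_of_mem_pfcClass)
      (hereditary_pfcClass hK.hereditary) hSAP'
  refine ⟨exists_isFraisseLimit hFraisse, fun N _ _ hN => ?_⟩
  have htrivial : HasTrivialAcl ((pfcLanguage L).completeTheory N) :=
    (hN.age.symm ▸ hSAP' : StrongAmalgamation ((pfcLanguage L).age N)).hasTrivialAcl
      hN.ultrahomogeneous
  exact ⟨htrivial.isGeometric, htrivial⟩
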